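/- **Prime Number Theorem.** For a natural number $N$ let $\pi(N)$ denote the number of primes $p \le N$, and let $\ln$ be the natural logarithm. Then $$\frac{\pi(N)}{N} \sim \frac{1}{\ln N} \qquad (N \to \infty),$$ that is, $\displaystyle\lim_{N\to\infty} \frac{\pi(N)/N}{1/\ln N} = 1$, where $N$ runs over the natural numbers. -/

import Mathlib

/-!
The proof deduces `ψ(x) ~ x` from the behaviour of `ζ` on the line `re s = 1` by a Tauberian
argument of Wiener–Ikehara type, and then passes from `ψ` to `π`.

Put `B(u) = ψ(exp u) exp(-u)`. By Chebyshev's estimate `B` is bounded, and partial summation shows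
that the Laplace transform of `B - 1` at `z = s - 1` is `L(Λ, s) / s - 1 / (s - 1)`. Since `ζ` has
only a simple pole at `1` and does not vanish on `re s ≥ 1`, this extends continuously to
`re z ≥ 0` (`exists_continuousOn_eq_laplace_psi`).

The Tauberian step averages `B - 1` against the Fejér kernel `u ↦ sinc² (l (y - u))`. This kernel
is the Fourier transform of a compactly supported triangle function, so the average is an integral
of the Laplace transform over a bounded segment of the imaginary axis, multiplied by an oscillating
exponential of frequency proportional to `y`. By the Riemann–Lebesgue lemma it tends to `0` as
`y → ∞`, for every `l > 0` (`tendsto_integral_mul_sinc_sq`). Hence the local averages of `B` tend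
to `1`. Because `exp u * B u = ψ(exp u)` is monotone, `B` cannot change quickly on short intervals
in the unfavourable direction, and large `l` concentrates the kernel on such intervals, which gives
`B(u) → 1` itself (`tendsto_one_of_laplace_continuousOn`).

Finally `ψ - θ = O(√x)` and `π(x) - θ(x) / log x = O(x / log² x)` turn this into the statement
about `π`.
-/

open Filter Topology MeasureTheory Set Real
open ArithmeticFunction.vonMangoldt Chebyshev

/-! ### The Fejér kernel -/

/-- The Fejér kernel `sinc²` is the Fourier transform of a triangle function. What matters is that
the triangle has compact support. -/
theorem sinc_sq_eq_integral (x : ℝ) :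
    ((sinc x ^ 2 : ℝ) : ℂ) =
      ∫ t in (-1 : ℝ)..1, ((1 - |t| : ℝ) : ℂ) * Complex.exp (2 * x * Complex.I * t) := by
  have hcont : Continuous fun t : ℝ ↦
      ((1 - |t| : ℝ) : ℂ) * Complex.exp (2 * x * Complex.I * t) := by fun_prop
  rw [← intervalIntegral.integral_add_adjacent_intervals (b := 0)
    (hcont.intervalIntegrable _ _) (hcont.intervalIntegrable _ _)]
  have hneg : ∫ t in (-1 : ℝ)..0, ((1 - |t| : ℝ) : ℂ) * Complex.exp (2 * x * Complex.I * t) =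
      ∫ t in (-1 : ℝ)..0, (1 + t : ℂ) * Complex.exp (2 * x * Complex.I * t) := by
    refine intervalIntegral.integral_congr fun t ht ↦ ?_
    rw [uIcc_of_le (by norm_num)] at ht
    simp [abs_of_nonpos ht.2]
  have hpos : ∫ t in (0 : ℝ)..1, ((1 - |t| : ℝ) : ℂ) * Complex.exp (2 * x * Complex.I * t) =
      ∫ t in (0 : ℝ)..1, (1 - t : ℂ) * Complex.exp (2 * x * Complex.I * t) := by
    refine intervalIntegral.integral_congr fun t ht ↦ ?_
    rw [uIcc_of_le (by norm_num)] at ht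
    simp [abs_of_nonneg ht.1]
  rw [hneg, hpos]
  rcases eq_or_ne x 0 with rfl | hx
  · have h₁ : ∫ t in (-1 : ℝ)..0, (1 + t : ℂ) = ((∫ t in (-1 : ℝ)..0, (1 + t) : ℝ) : ℂ) := by
      rw [← intervalIntegral.integral_ofReal]; simp
    have h₂ : ∫ t in (0 : ℝ)..1, (1 - t : ℂ) = ((∫ t in (0 : ℝ)..1, (1 - t) : ℝ) : ℂ) := by
      rw [← intervalIntegral.integral_ofReal]; simp
    simp only [Complex.ofReal_zero, mul_zero, zero_mul, Complex.exp_zero, mul_one, sinc_zero,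
      h₁, h₂]
    rw [intervalIntegral.integral_add (by simp) (by simp),
      intervalIntegral.integral_sub (by simp) (by simp)]
    simp only [intervalIntegral.integral_const, integral_id]
    norm_num
  -- For `x ≠ 0` both halves have elementary antiderivatives, and the boundary terms add up to
  -- `(exp c + exp (-c) - 2) / c ^ 2`, which is `(sin x / x) ^ 2`.
  · set c : ℂ := 2 * x * Complex.I with hc
    have hc0 : c ≠ 0 := by simp [hc, hx]
    have hexp (t : ℝ) :
        HasDerivAt (fun t : ℝ ↦ Complex.exp (c * t)) (c * Complex.exp (c * t)) t := by
      have := ((Complex.ofRealCLM.hasDerivAt (x := t)).const_mul c).cexp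
      simpa [mul_comm] using this
    have hid (t : ℝ) : HasDerivAt (fun t : ℝ ↦ (t : ℂ)) 1 t := Complex.ofRealCLM.hasDerivAt
    rw [intervalIntegral.integral_eq_sub_of_hasDerivAt
        (f := fun t : ℝ ↦ ((1 + t) / c - 1 / c ^ 2) * Complex.exp (c * t)),
      intervalIntegral.integral_eq_sub_of_hasDerivAt
        (f := fun t : ℝ ↦ ((1 - t) / c + 1 / c ^ 2) * Complex.exp (c * t))]
    · rw [sinc_of_ne_zero hx]
      have h2 : Complex.exp c = Complex.exp (x * Complex.I) ^ 2 := by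
        rw [← Complex.exp_nat_mul, hc]; congr 1; push_cast; ring
      have h3 : Complex.exp (-c) = Complex.exp (-(x * Complex.I)) ^ 2 := by
        rw [← Complex.exp_nat_mul, hc]; congr 1; push_cast; ring
      have h4 : Complex.exp (x * Complex.I) * Complex.exp (-(x * Complex.I)) = 1 := by
        rw [← Complex.exp_add]; simp
      have hxc : (x : ℂ) ≠ 0 := by simpa using hx
      push_cast
      rw [Complex.sin]
      simp only [mul_zero, Complex.exp_zero, mul_one, mul_neg, h2, h3, neg_mul]
      generalize Complex.exp (x * Complex.I) = p at *
      generalize Complex.exp (-(x * Complex.I)) = q at *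
      rw [hc]
      field_simp
      ring_nf
      simp only [Complex.I_pow_four]
      linear_combination (-2) * h4
    · intro t _
      convert! ((((hid t).const_sub 1).div_const c).add_const (1 / c ^ 2)).mul (hexp t) using 1
      field_simp
      ring
    · exact Continuous.intervalIntegrable (by fun_prop) _ _
    · intro t _
      convert! ((((hid t).const_add 1).div_const c).sub_const (1 / c ^ 2)).mul (hexp t) using 1
      field_simp
      ring
    · exact Continuous.intervalIntegrable (by fun_prop) _ _

theorem integrable_sinc_sq : Integrable fun x : ℝ ↦ sinc x ^ 2 := by
  -- Both `sinc² x` and `x² sinc² x = sin² x` are at most `1`, so `sinc² x ≤ 2 / (1 + x²)`.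
  refine (integrable_inv_one_add_sq.const_mul 2).mono' (by fun_prop) (ae_of_all _ fun x ↦ ?_)
  rw [norm_of_nonneg (sq_nonneg _), ← div_eq_mul_inv, le_div_iff₀ (by positivity)]
  have h1 : sinc x ^ 2 ≤ 1 := by
    rw [sq_le_one_iff_abs_le_one]; exact abs_sinc_le_one x
  have h2 : sinc x ^ 2 * x ^ 2 ≤ 1 := by
    rcases eq_or_ne x 0 with rfl | hx
    · simp
    · rw [sinc_of_ne_zero hx, div_pow, div_mul_cancel₀ _ (by positivity)]
      exact sin_sq_le_one x
  linarith

theorem integral_sinc_sq_pos : 0 < ∫ x : ℝ, sinc x ^ 2 := by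
  refine integral_pos_of_integrable_nonneg_nonzero (x := 0) (by fun_prop) integrable_sinc_sq
    (fun x ↦ sq_nonneg _) (by simp)

theorem integrable_sinc_sq_comp {l : ℝ} (hl : 0 < l) (y : ℝ) :
    Integrable fun u : ℝ ↦ sinc (l * (y - u)) ^ 2 :=
  (integrable_sinc_sq.comp_mul_left' hl.ne').comp_sub_left y

theorem integral_sinc_sq_comp (l y : ℝ) :
    ∫ u, sinc (l * (y - u)) ^ 2 = ∫ u, sinc (l * u) ^ 2 :=
  integral_sub_left_eq_self (fun u ↦ sinc (l * u) ^ 2) volume y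

theorem tendsto_integral_Ioi_sinc_sq {l : ℝ} (hl : 0 < l) :
    Tendsto (fun y ↦ ∫ u in Ioi (0 : ℝ), sinc (l * (y - u)) ^ 2) atTop
      (𝓝 (∫ u, sinc (l * u) ^ 2)) := by
  have h := AECover.integral_tendsto_of_countably_generated
    (aecover_Iio (μ := volume) (tendsto_id (α := ℝ) (x := atTop)))
    (integrable_sinc_sq.comp_mul_left' hl.ne')
  refine h.congr fun y ↦ ?_
  rw [← integral_indicator measurableSet_Iio, ← integral_indicator measurableSet_Ioi,
    ← integral_sub_left_eq_self _ volume y]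
  congr 1
  funext u
  simp [indicator]

/-- A sufficiently strong rescaling of the Fejér kernel has all but an `ε`-fraction of its mass
on `[-a, a]`. -/
theorem exists_integral_sinc_sq_concentrated {a : ℝ} (ha : 0 < a) {ε : ℝ} (hε : 0 < ε) :
    ∃ l > 0, (1 - ε) * ∫ u, sinc (l * u) ^ 2 ≤ ∫ u in Icc (-a) a, sinc (l * u) ^ 2 := by
  set J := ∫ u : ℝ, sinc u ^ 2
  have hJ : 0 < J := integral_sinc_sq_pos
  have hlim : Tendsto (fun l : ℝ ↦ ∫ u in (l * -a)..(l * a), sinc u ^ 2) atTop (𝓝 J) :=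
    intervalIntegral_tendsto_integral integrable_sinc_sq
      (tendsto_id.atTop_mul_const_of_neg (by linarith)) (tendsto_id.atTop_mul_const ha)
  obtain ⟨l, hl, hl0⟩ := ((hlim.eventually_const_le (show (1 - ε) * J < J by nlinarith)).and
    (eventually_gt_atTop 0)).exists
  refine ⟨l, hl0, ?_⟩
  rw [integral_Icc_eq_integral_Ioc, ← intervalIntegral.integral_of_le (by linarith),
    intervalIntegral.integral_comp_mul_left (fun u ↦ sinc u ^ 2) hl0.ne',
    Measure.integral_comp_mul_left (fun u ↦ sinc u ^ 2), abs_of_pos (inv_pos.mpr hl0), smul_eq_mul,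
    smul_eq_mul, mul_left_comm]
  exact mul_le_mul_of_nonneg_left hl (inv_pos.mpr hl0).le

theorem integral_Icc_sinc_sq_comp (l y a : ℝ) :
    ∫ u in Icc (y - a) (y + a), sinc (l * (y - u)) ^ 2 = ∫ u in Icc (-a) a, sinc (l * u) ^ 2 := by
  rw [← integral_indicator measurableSet_Icc, ← integral_indicator measurableSet_Icc,
    ← integral_sub_left_eq_self _ volume y]
  congr 1
  funext u
  simp only [indicator, mem_Icc]
  congr 1
  · rw [eq_iff_iff]
    constructor <;> rintro ⟨_, _⟩ <;> constructor <;> linarith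
  · rw [sub_sub_cancel]

/-! ### Averages of functions with a continuous Laplace transform -/

/-- Fubini: integrating `f` against the Fejér kernel only involves the Laplace transform of `f` on
a bounded vertical segment. The factor `exp (-σ u)` makes the double integral absolutely
convergent. -/
theorem integral_mul_sinc_sq {f : ℝ → ℝ} (hf : Measurable f) {C : ℝ} (hC : ∀ u, |f u| ≤ C)
    {G : ℂ → ℂ}
    (hfG : ∀ z : ℂ, 0 < z.re → G z = ∫ u in Ioi (0 : ℝ), (f u : ℂ) * Complex.exp (-(z * u)))
    {σ : ℝ} (hσ : 0 < σ) (l y : ℝ) :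
    ∫ t in (-1 : ℝ)..1, Complex.exp (2 * (l * y) * Complex.I * t) *
        (((1 - |t| : ℝ) : ℂ) * G (σ + 2 * l * t * Complex.I)) =
      ((∫ u in Ioi (0 : ℝ), exp (-(σ * u)) * (f u * sinc (l * (y - u)) ^ 2) : ℝ) : ℂ) := by
  rw [← integral_complex_ofReal]
  have hswap : Integrable (Function.uncurry fun t u : ℝ ↦
      ((1 - |t| : ℝ) : ℂ) * Complex.exp (2 * (l * (y - u) : ℝ) * Complex.I * t) *
        (exp (-(σ * u)) * f u : ℝ))
      ((volume.restrict (Ioc (-1 : ℝ) 1)).prod (volume.restrict (Ioi (0 : ℝ)))) := by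
    have h1 : Integrable (fun _ : ℝ ↦ (1 : ℝ)) (volume.restrict (Ioc (-1 : ℝ) 1)) := by simp
    have h2 : Integrable (fun u : ℝ ↦ C * exp (-σ * u)) (volume.restrict (Ioi (0 : ℝ))) :=
      (integrableOn_exp_mul_Ioi (by linarith) 0).const_mul C
    refine (h1.mul_prod h2).mono' ?_ ?_
    · apply Measurable.aestronglyMeasurable
      have : Measurable fun p : ℝ × ℝ ↦ f p.2 := hf.comp measurable_snd
      unfold Function.uncurry
      fun_prop
    · rw [Measure.prod_restrict]
      refine (ae_restrict_iff' (measurableSet_Ioc.prod measurableSet_Ioi)).mpr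
        (ae_of_all _ fun p hp ↦ ?_)
      have ht : |p.1| ≤ 1 := abs_le.mpr ⟨hp.1.1.le, hp.1.2⟩
      have he : ‖Complex.exp (2 * (l * (y - p.2) : ℝ) * Complex.I * p.1)‖ = 1 := by
        rw [Complex.norm_exp]; simp
      simp only [Function.uncurry]
      rw [norm_mul, norm_mul, he, Complex.norm_real, Complex.norm_real, norm_mul,
        norm_of_nonneg (exp_pos _).le, norm_of_nonneg (by linarith), mul_one]
      refine mul_le_mul (by linarith [abs_nonneg p.1]) ?_ (by positivity) zero_le_one
      rw [mul_comm, neg_mul]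
      exact mul_le_mul_of_nonneg_right (hC _) (exp_pos _).le
  rw [intervalIntegral.integral_of_le (by norm_num)]
  calc _ = ∫ t in Ioc (-1 : ℝ) 1, ∫ u in Ioi (0 : ℝ),
      ((1 - |t| : ℝ) : ℂ) * Complex.exp (2 * (l * (y - u) : ℝ) * Complex.I * t) *
        (exp (-(σ * u)) * f u : ℝ) := ?_
    _ = _ := integral_integral_swap hswap
    _ = _ := ?_
  · refine integral_congr_ae (ae_of_all _ fun t ↦ ?_)
    simp only
    rw [hfG _ (by simpa using hσ), ← integral_const_mul, ← integral_const_mul]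
    refine integral_congr_ae (ae_of_all _ fun u ↦ ?_)
    have : Complex.exp (2 * (l * y) * Complex.I * t) *
        Complex.exp (-((σ + 2 * l * t * Complex.I) * u)) =
        Complex.exp (2 * (l * (y - u) : ℝ) * Complex.I * t) * Complex.exp (-(σ * u)) := by
      rw [← Complex.exp_add, ← Complex.exp_add]
      congr 1
      push_cast
      ring
    push_cast at this ⊢
    linear_combination ((1 - ((|t| : ℝ) : ℂ)) * f u) * this
  · refine integral_congr_ae (ae_of_all _ fun u ↦ ?_)
    simp only
    rw [integral_mul_const, ← intervalIntegral.integral_of_le (by norm_num), ← sinc_sq_eq_integral]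
    push_cast
    ring

/-- If the Laplace transform of a bounded function `f` on `(0, ∞)` extends continuously to the
imaginary axis, then the averages of `f` against Fejér kernels centred at `y` tend to `0`. -/
theorem tendsto_integral_mul_sinc_sq {f : ℝ → ℝ} (hf : Measurable f) {C : ℝ}
    (hC : ∀ u, |f u| ≤ C) {G : ℂ → ℂ} (hG : ContinuousOn G {z | 0 ≤ z.re})
    (hfG : ∀ z : ℂ, 0 < z.re → G z = ∫ u in Ioi (0 : ℝ), (f u : ℂ) * Complex.exp (-(z * u)))
    {l : ℝ} (hl : 0 < l) :
    Tendsto (fun y ↦ ∫ u in Ioi (0 : ℝ), f u * sinc (l * (y - u)) ^ 2) atTop (𝓝 0) := by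
  set g : ℝ → ℂ := fun t ↦ ((1 - |t| : ℝ) : ℂ) * G (2 * l * t * Complex.I) with hg
  -- Letting `σ → 0+` in `integral_mul_sinc_sq` moves the segment to the imaginary axis.
  have key (y : ℝ) : ∫ t in (-1 : ℝ)..1, Complex.exp (2 * (l * y) * Complex.I * t) * g t =
      ((∫ u in Ioi (0 : ℝ), f u * sinc (l * (y - u)) ^ 2 : ℝ) : ℂ) := by
    have hpath : ContinuousOn (fun p : ℝ × ℝ ↦ G (p.1 + 2 * l * p.2 * Complex.I))
        (Icc 0 1 ×ˢ Icc (-1) 1) :=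
      hG.comp (by fun_prop) fun p hp ↦ by simpa using hp.1.1
    obtain ⟨M, hM⟩ := (isCompact_Icc.prod isCompact_Icc).exists_bound_of_continuousOn hpath
    have hσ : ∀ᶠ σ : ℝ in 𝓝[>] 0, σ ∈ Ioc (0 : ℝ) 1 := Ioc_mem_nhdsGT zero_lt_one
    refine tendsto_nhds_unique (f := fun σ : ℝ ↦ ∫ t in (-1 : ℝ)..1,
      Complex.exp (2 * (l * y) * Complex.I * t) *
        (((1 - |t| : ℝ) : ℂ) * G (σ + 2 * l * t * Complex.I))) (l := 𝓝[>] 0) ?_ ?_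
    · refine intervalIntegral.tendsto_integral_filter_of_dominated_convergence (fun _ ↦ M) ?_ ?_
        (by simp) ?_
      · filter_upwards [hσ] with σ hσ
        refine ContinuousOn.aestronglyMeasurable ?_ measurableSet_uIoc
        refine ContinuousOn.mul (by fun_prop) (ContinuousOn.mul (by fun_prop) ?_)
        exact hG.comp (by fun_prop) fun t _ ↦ by simpa using hσ.1.le
      · filter_upwards [hσ] with σ hσ
        refine ae_of_all _ fun t ht ↦ ?_
        rw [uIoc_of_le (by norm_num)] at ht
        have h1 : |t| ≤ 1 := abs_le.mpr ⟨ht.1.le, ht.2⟩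
        have h2 := hM (σ, t) ⟨⟨hσ.1.le, hσ.2⟩, ht.1.le, ht.2⟩
        have he : ‖Complex.exp (2 * (l * y) * Complex.I * t)‖ = 1 := by
          rw [Complex.norm_exp]; simp
        rw [norm_mul, norm_mul, he, one_mul, Complex.norm_real, norm_of_nonneg (by linarith)]
        exact (mul_le_of_le_one_left (norm_nonneg _) (by linarith [abs_nonneg t])).trans h2
      · refine ae_of_all _ fun t _ ↦ (Tendsto.const_mul _ (Tendsto.const_mul _ ?_))
        have h0 := (hG (2 * l * t * Complex.I) (by simp)).tendsto
        refine h0.comp (tendsto_nhdsWithin_iff.mpr ⟨?_, ?_⟩)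
        · refine tendsto_nhdsWithin_of_tendsto_nhds ?_
          refine Continuous.tendsto' (by fun_prop) _ _ (by simp)
        · filter_upwards [hσ] with σ hσ
          simpa using hσ.1.le
    · refine Tendsto.congr' (f₁ := fun σ : ℝ ↦
        ((∫ u in Ioi (0 : ℝ), exp (-(σ * u)) * (f u * sinc (l * (y - u)) ^ 2) : ℝ) : ℂ)) ?_ ?_
      · filter_upwards [hσ] with σ hσ
        exact (integral_mul_sinc_sq hf hC hfG hσ.1 l y).symm
      · refine (Complex.continuous_ofReal.tendsto _).comp ?_
        refine tendsto_integral_filter_of_dominated_convergence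
          (fun u ↦ C * sinc (l * (y - u)) ^ 2) ?_ ?_
          ((integrable_sinc_sq_comp hl y).const_mul C).integrableOn ?_
        · exact Eventually.of_forall fun σ ↦ by
            apply Measurable.aestronglyMeasurable; fun_prop
        · filter_upwards [hσ] with σ hσ
          refine (ae_restrict_iff' measurableSet_Ioi).mpr (ae_of_all _ fun u hu ↦ ?_)
          have hu : 0 < u := hu
          rw [norm_mul, norm_mul, norm_of_nonneg (exp_pos _).le,
            norm_of_nonneg (sq_nonneg (sinc _))]
          refine (mul_le_of_le_one_left (by positivity) ?_).trans
            (mul_le_mul_of_nonneg_right (hC u) (sq_nonneg _))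
          exact exp_le_one_iff.mpr (by have := mul_pos hσ.1 hu; linarith)
        · refine ae_of_all _ fun u ↦ ?_
          refine tendsto_nhdsWithin_of_tendsto_nhds ?_
          exact Continuous.tendsto' (by fun_prop) _ _ (by simp)
  -- The averages are now values of the Fourier transform of `g`, cut off to `(-1, 1]`, at the
  -- frequency `-(l / π) * y`.
  have hRL := (Real.tendsto_integral_exp_smul_cocompact ((Ioc (-1) 1).indicator g)).comp
    (f := fun y : ℝ ↦ -(l / π) * y) (x := atTop) (y := cocompact ℝ)
    (by
      rw [cocompact_eq_atBot_atTop]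
      exact (tendsto_id.const_mul_atTop_of_neg (by simpa using div_pos hl pi_pos)).mono_right
        le_sup_left)
  have hre := (Complex.continuous_re.tendsto 0).comp hRL
  refine hre.congr fun y ↦ ?_
  simp only [Function.comp_apply]
  rw [← Complex.ofReal_re (∫ u in Ioi (0 : ℝ), f u * sinc (l * (y - u)) ^ 2), ← key y,
    intervalIntegral.integral_of_le (by norm_num), ← integral_indicator measurableSet_Ioc]
  congr 2
  funext t
  by_cases ht : t ∈ Ioc (-1 : ℝ) 1
  · rw [indicator_of_mem ht, indicator_of_mem ht, Circle.smul_def, Real.fourierChar_apply,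
      smul_eq_mul]
    congr 2
    push_cast
    have : (π : ℂ) ≠ 0 := by exact_mod_cast pi_ne_zero
    field_simp
  · rw [indicator_of_notMem ht, indicator_of_notMem ht, smul_zero]

/-! ### The Tauberian theorem -/

/-- A Tauberian theorem of Wiener–Ikehara type for bounded functions: the hypothesis on `G` says
that the Laplace transform of `B - 1` extends continuously to the imaginary axis. -/
theorem tendsto_one_of_laplace_continuousOn {B : ℝ → ℝ}
    (hmono : Monotone fun u ↦ exp u * B u) (hB0 : ∀ u, 0 ≤ B u) {C : ℝ} (hBC : ∀ u, B u ≤ C)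
    {G : ℂ → ℂ} (hG : ContinuousOn G {z | 0 ≤ z.re})
    (hBG : ∀ z : ℂ, 0 < z.re →
      G z = ∫ u in Ioi (0 : ℝ), ((B u - 1 : ℝ) : ℂ) * Complex.exp (-(z * u))) :
    Tendsto B atTop (𝓝 1) := by
  have hBmeas : Measurable B := by
    have : B = fun u ↦ exp (-u) * (exp u * B u) := by
      funext u; rw [← mul_assoc, ← exp_add]; simp
    rw [this]
    exact Measurable.mul (by fun_prop) hmono.measurable
  have hC0 : 0 ≤ C := (hB0 0).trans (hBC 0)
  have hint {l : ℝ} (hl : 0 < l) (y : ℝ) : Integrable fun u ↦ B u * sinc (l * (y - u)) ^ 2 :=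
    (integrable_sinc_sq_comp hl y).bdd_mul hBmeas.aestronglyMeasurable
      (ae_of_all _ fun u ↦ (norm_of_nonneg (hB0 u)).trans_le (hBC u))
  -- Adding the mass of the kernel on `(0, ∞)` to its integral against `B - 1` gives the averages
  -- of `B`.
  have havg {l : ℝ} (hl : 0 < l) :
      Tendsto (fun y ↦ ∫ u in Ioi (0 : ℝ), B u * sinc (l * (y - u)) ^ 2) atTop
        (𝓝 (∫ u, sinc (l * u) ^ 2)) := by
    have h := (tendsto_integral_mul_sinc_sq (hBmeas.sub_const 1) (C := C + 1)
      (fun u ↦ abs_le.mpr ⟨by linarith [hB0 u], by linarith [hBC u]⟩) hG hBG hl).add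
      (tendsto_integral_Ioi_sinc_sq hl)
    rw [zero_add] at h
    refine h.congr fun y ↦ ?_
    simp only [sub_mul, one_mul]
    rw [integral_sub (hint hl y).integrableOn (integrable_sinc_sq_comp hl y).integrableOn,
      sub_add_cancel]
  -- Monotonicity of `exp u * B u` in the form used below: `B` can only drop slowly.
  have hcmp {u v : ℝ} (h : u ≤ v) : B u ≤ exp (v - u) * B v := by
    have := hmono h
    simp only at this
    rw [exp_sub, div_mul_eq_mul_div, le_div_iff₀ (exp_pos u)]
    linarith
  -- Two-sided bounds for `B y`, with constants tending to `1` as `a → 0`.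
  have hcore {a : ℝ} (ha : 0 < a) (ha1 : a < 1) : ∀ᶠ y in atTop,
      (1 - a) * B y ≤ exp (2 * a) * (1 + a) ∧ 1 - a - C * a ≤ exp (2 * a) * B y := by
    obtain ⟨l, hl, hla⟩ := exists_integral_sinc_sq_concentrated ha ha
    set J := ∫ u, sinc (l * u) ^ 2 with hJdef
    have hJ : 0 < J := by
      rw [hJdef, Measure.integral_comp_mul_left (fun u ↦ sinc u ^ 2), smul_eq_mul]
      exact mul_pos (abs_pos.mpr (inv_ne_zero hl.ne')) integral_sinc_sq_pos
    have hup := ((havg hl).comp (tendsto_atTop_add_const_right _ a tendsto_id)).eventually_le_const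
      (show J < (1 + a) * J by nlinarith)
    have hlow :=
      ((havg hl).comp (tendsto_atTop_add_const_right _ (-a) tendsto_id)).eventually_const_le
      (show (1 - a) * J < J by nlinarith)
    filter_upwards [hup, hlow, eventually_gt_atTop 0] with y hup hlow hy
    simp only [Function.comp_apply, id] at hup hlow
    constructor
    -- The kernel centred at `y + a` has most of its mass on `[y, y + 2a]`, where
    -- `B u ≥ exp (-2a) * B y`.
    · have h1 : exp (-(2 * a)) * B y * ((1 - a) * J) ≤ (1 + a) * J := by
        calc _ ≤ exp (-(2 * a)) * B y *
              ∫ u in Icc ((y + a) - a) ((y + a) + a), sinc (l * ((y + a) - u)) ^ 2 := by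
              rw [integral_Icc_sinc_sq_comp]
              exact mul_le_mul_of_nonneg_left hla (mul_nonneg (exp_pos _).le (hB0 y))
          _ = ∫ u in Icc ((y + a) - a) ((y + a) + a),
                exp (-(2 * a)) * B y * sinc (l * ((y + a) - u)) ^ 2 :=
              (integral_const_mul _ _).symm
          _ ≤ ∫ u in Icc ((y + a) - a) ((y + a) + a), B u * sinc (l * ((y + a) - u)) ^ 2 := by
              refine setIntegral_mono_on
                ((integrable_sinc_sq_comp hl _).const_mul _).integrableOn (hint hl _).integrableOn
                measurableSet_Icc fun u hu ↦ mul_le_mul_of_nonneg_right ?_ (sq_nonneg _)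
              have h2 : B y ≤ exp (u - y) * B u := hcmp (by linarith [hu.1])
              have h3 : exp (u - y) * B u ≤ exp (2 * a) * B u :=
                mul_le_mul_of_nonneg_right (exp_le_exp.mpr (by linarith [hu.2])) (hB0 u)
              rw [exp_neg, inv_mul_le_iff₀ (exp_pos _)]
              exact h2.trans h3
          _ ≤ ∫ u in Ioi (0 : ℝ), B u * sinc (l * ((y + a) - u)) ^ 2 := by
              refine setIntegral_mono_set (hint hl _).integrableOn
                (ae_of_all _ fun u ↦ mul_nonneg (hB0 u) (sq_nonneg _))
                (LE.le.eventuallyLE fun u hu ↦ ?_)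
              change 0 < u
              linarith [hu.1]
          _ ≤ _ := hup
      rw [exp_neg] at h1
      have h2 : (exp (2 * a))⁻¹ * ((1 - a) * B y) ≤ 1 + a :=
        le_of_mul_le_mul_right (by linarith) hJ
      rwa [inv_mul_le_iff₀ (exp_pos _)] at h2
    -- The kernel centred at `y - a` has most of its mass on `[y - 2a, y]`, where
    -- `B u ≤ exp (2a) * B y`; the rest is controlled by `B ≤ C`.
    · set S := Icc ((y + -a) - a) ((y + -a) + a) with hS
      set k : ℝ → ℝ := fun u ↦ sinc (l * ((y + -a) - u)) ^ 2 with hk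
      have hk0 (u : ℝ) : 0 ≤ k u := sq_nonneg _
      have hkint : Integrable k := integrable_sinc_sq_comp hl _
      have hsum : ∫ u, k u = J := integral_sinc_sq_comp l _
      have hsplit := integral_add_compl (s := S) measurableSet_Icc hkint
      have hmass : (1 - a) * J ≤ ∫ u in S, k u := by
        rw [hS, hk, integral_Icc_sinc_sq_comp]; exact hla
      have h1 : (1 - a) * J ≤ exp (2 * a) * B y * J + C * (a * J) := by
        calc _ ≤ ∫ u in Ioi (0 : ℝ), B u * k u := hlow
          _ ≤ ∫ u, B u * k u := setIntegral_le_integral (hint hl _)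
              (ae_of_all _ fun u ↦ mul_nonneg (hB0 u) (hk0 u))
          _ = (∫ u in S, B u * k u) + ∫ u in Sᶜ, B u * k u :=
              (integral_add_compl measurableSet_Icc (hint hl _)).symm
          _ ≤ (∫ u in S, exp (2 * a) * B y * k u) + ∫ u in Sᶜ, C * k u := by
              refine add_le_add ?_ ?_
              · refine setIntegral_mono_on (hint hl _).integrableOn
                  (hkint.const_mul _).integrableOn measurableSet_Icc fun u hu ↦
                  mul_le_mul_of_nonneg_right ?_ (hk0 u)
                refine (hcmp (show u ≤ y by linarith [hu.2])).trans
                  (mul_le_mul_of_nonneg_right (exp_le_exp.mpr ?_) (hB0 y))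
                linarith [hu.1]
              · exact integral_mono (hint hl _).integrableOn (hkint.const_mul _).integrableOn
                  fun u ↦ mul_le_mul_of_nonneg_right (hBC u) (hk0 u)
          _ ≤ _ := by
              rw [integral_const_mul, integral_const_mul]
              have h3 : 0 ≤ ∫ u in Sᶜ, k u := integral_nonneg hk0
              refine add_le_add (mul_le_mul_of_nonneg_left ?_
                (mul_nonneg (exp_pos _).le (hB0 y))) (mul_le_mul_of_nonneg_left ?_ hC0) <;>
              linarith
      refine le_of_mul_le_mul_right ?_ hJ
      linarith
  rw [tendsto_order]
  refine ⟨fun b hb ↦ ?_, fun b hb ↦ ?_⟩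
  · have hlim : Tendsto (fun a : ℝ ↦ exp (2 * a) * b - (1 - a - C * a)) (𝓝[>] 0) (𝓝 (b - 1)) :=
      tendsto_nhdsWithin_of_tendsto_nhds (Continuous.tendsto' (by fun_prop) _ _ (by simp))
    obtain ⟨a, ha, ha0, ha1⟩ := ((hlim.eventually_lt_const (show b - 1 < 0 by linarith)).and
      (Ioo_mem_nhdsGT zero_lt_one)).exists
    filter_upwards [hcore ha0 ha1] with y hy
    exact lt_of_mul_lt_mul_left (by linarith [hy.2]) (exp_pos (2 * a)).le
  · have hlim : Tendsto (fun a : ℝ ↦ exp (2 * a) * (1 + a) - (1 - a) * b) (𝓝[>] 0) (𝓝 (1 - b)) :=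
      tendsto_nhdsWithin_of_tendsto_nhds (Continuous.tendsto' (by fun_prop) _ _ (by simp))
    obtain ⟨a, ha, ha0, ha1⟩ := ((hlim.eventually_lt_const (show 1 - b < 0 by linarith)).and
      (Ioo_mem_nhdsGT zero_lt_one)).exists
    filter_upwards [hcore ha0 ha1] with y hy
    exact lt_of_mul_lt_mul_left (by linarith [hy.1]) (show 0 ≤ 1 - a by linarith)

/-! ### The Laplace transform of the Chebyshev function -/

/-- Partial summation for `L(Λ, s)` at `s = 1 + z`, after the substitution `t = exp u`. -/
theorem LSeries_vonMangoldt_one_add_eq {z : ℂ} (hz : 0 < z.re) :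
    LSeries (fun n ↦ (ArithmeticFunction.vonMangoldt n : ℂ)) (1 + z) = (1 + z) *
      ∫ u in Ioi (0 : ℝ), ((psi (exp u) * exp (-u) : ℝ) : ℂ) * Complex.exp (-(z * u)) := by
  have hsum (t : ℝ) : ∑ k ∈ Finset.Icc 1 ⌊t⌋₊, ArithmeticFunction.vonMangoldt k = psi t := rfl
  rw [LSeries_eq_mul_integral_of_nonneg (fun n ↦ ArithmeticFunction.vonMangoldt n) zero_le_one
    (by simpa using hz) ?_ fun _ ↦ ArithmeticFunction.vonMangoldt_nonneg]
  · congr 1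
    rw [← exp_zero, ← image_exp_Ioi, integral_image_eq_integral_abs_deriv_smul measurableSet_Ioi
      (fun x _ ↦ (hasDerivAt_exp x).hasDerivWithinAt) exp_injective.injOn]
    refine setIntegral_congr_fun measurableSet_Ioi fun u _ ↦ ?_
    rw [← Complex.ofReal_sum, hsum, abs_of_pos (exp_pos u), Complex.real_smul,
      Complex.cpow_def_of_ne_zero (by simp),
      ← Complex.ofReal_log (exp_pos u).le, log_exp]
    push_cast
    rw [mul_left_comm, mul_assoc, ← Complex.exp_add, ← Complex.exp_add]
    congr 2
    ring
  · refine Asymptotics.IsBigO.of_bound (log 4 + 4) (Eventually.of_forall fun n ↦ ?_)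
    have h := psi_le_const_mul_self (Nat.cast_nonneg n)
    have h0 := psi_nonneg (n : ℝ)
    rw [← hsum, Nat.floor_natCast] at h h0
    simpa [abs_of_nonneg h0] using h

/-- The Laplace transform of `ψ(exp u) exp(-u) - 1` extends continuously to the imaginary axis.
With `s = 1 + z` the transform is `L(Λ, s) / s - 1 / (s - 1)`, that is
`((L(Λ, s) - 1 / (s - 1)) - 1) / s`; the inner bracket is continuous on `re s ≥ 1` because `ζ` has
a simple pole at `1` and no zeros on `re s ≥ 1`. Mathlib records this for residue classes; the
class of `1` modulo `1` contains every integer. -/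
theorem exists_continuousOn_eq_laplace_psi :
    ∃ G : ℂ → ℂ, ContinuousOn G {z | 0 ≤ z.re} ∧ ∀ z : ℂ, 0 < z.re →
    G z = ∫ u in Ioi (0 : ℝ), ((psi (exp u) * exp (-u) - 1 : ℝ) : ℂ) * Complex.exp (-(z * u)) := by
  refine ⟨fun z ↦ (LFunctionResidueClassAux (1 : ZMod 1) (1 + z) - 1) / (1 + z), ?_, fun z hz ↦ ?_⟩
  · refine ContinuousOn.div (ContinuousOn.sub ?_ continuousOn_const) (by fun_prop) fun z hz h ↦ ?_
    · exact (continuousOn_LFunctionResidueClassAux (1 : ZMod 1)).comp (by fun_prop)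
        fun z hz ↦ by simpa using hz
    · have := congrArg Complex.re h
      simp only [Complex.add_re, Complex.one_re, Complex.zero_re] at this
      linarith [show 0 ≤ z.re from hz]
  · have hz1 : 1 + z ≠ 0 := fun h ↦ by
      have := congrArg Complex.re h
      simp only [Complex.add_re, Complex.one_re, Complex.zero_re] at this
      linarith
    have hz0 : z ≠ 0 := by rintro rfl; simp at hz
    have hint : IntegrableOn (fun u : ℝ ↦ Complex.exp (-(z * u))) (Ioi 0) := by
      simpa using integrableOn_exp_mul_complex_Ioi (a := -z) (by simpa using hz) 0
    have hval : ∫ u in Ioi (0 : ℝ), Complex.exp (-(z * u)) = 1 / z := by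
      simpa using integral_exp_mul_complex_Ioi (a := -z) (by simpa using hz) 0
    have hint' : IntegrableOn (fun u : ℝ ↦
        ((psi (exp u) * exp (-u) : ℝ) : ℂ) * Complex.exp (-(z * u))) (Ioi 0) := by
      refine Integrable.bdd_mul (c := log 4 + 4) hint ?_ ?_
      · exact (((psi_mono.measurable.comp measurable_exp).mul
          (by fun_prop)).complex_ofReal).aestronglyMeasurable
      · refine ae_of_all _ fun u ↦ ?_
        rw [Complex.norm_real, norm_of_nonneg (mul_nonneg (psi_nonneg _) (exp_pos _).le), exp_neg,
          ← div_eq_mul_inv, div_le_iff₀ (exp_pos u)]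
        exact psi_le_const_mul_self (exp_pos u).le
    have hΛ : (fun n ↦ (residueClass (1 : ZMod 1) n : ℂ)) =
        fun n ↦ (ArithmeticFunction.vonMangoldt n : ℂ) := by
      funext n
      rw [residueClass, Set.indicator_of_mem
        (show n ∈ {n : ℕ | (n : ZMod 1) = 1} from Subsingleton.elim _ _)]
    simp only [Complex.ofReal_sub, Complex.ofReal_one, sub_mul, one_mul]
    rw [integral_sub hint' hint, hval,
      eqOn_LFunctionResidueClassAux (a := (1 : ZMod 1)) isUnit_one (by simpa using hz)]
    simp only [hΛ, LSeries_vonMangoldt_one_add_eq hz, Nat.totient_one, Nat.cast_one,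
      inv_one, add_sub_cancel_left]
    field_simp
    ring

/-! ### From `ψ` to `π` -/

theorem tendsto_psi_div_self : Tendsto (fun x ↦ psi x / x) atTop (𝓝 1) := by
  obtain ⟨G, hG, hGψ⟩ := exists_continuousOn_eq_laplace_psi
  have h := tendsto_one_of_laplace_continuousOn (B := fun u ↦ psi (exp u) * exp (-u))
    (C := log 4 + 4) ?_ (fun u ↦ mul_nonneg (psi_nonneg _) (exp_pos _).le) ?_ hG hGψ
  · refine (h.comp tendsto_log_atTop).congr' ?_
    filter_upwards [eventually_gt_atTop 0] with x hx
    simp only [Function.comp_apply]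
    rw [exp_neg, exp_log hx, div_eq_mul_inv]
  · have : (fun u ↦ exp u * (psi (exp u) * exp (-u))) = fun u ↦ psi (exp u) := by
      funext u
      rw [mul_left_comm, ← exp_add, add_neg_cancel, exp_zero, mul_one]
    rw [this]
    exact psi_mono.comp exp_monotone
  · intro u
    rw [exp_neg, ← div_eq_mul_inv, div_le_iff₀ (exp_pos u)]
    exact psi_le_const_mul_self (exp_pos u).le

theorem mainTheorem4 :
    Asymptotics.IsEquivalent Filter.atTop
      (fun N : ℕ => (Nat.primeCounting N : ℝ) / (N : ℝ))
      (fun N : ℕ => 1 / Real.log (N : ℝ)) := by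
  have hθ : Tendsto (fun x ↦ theta x / x) atTop (𝓝 1) := by
    have h0 : Tendsto (fun x ↦ (psi x - theta x) / x) atTop (𝓝 0) := by
      refine (isBigO_psi_sub_theta_sqrt.trans_isLittleO ?_).tendsto_div_nhds_zero
      refine (Asymptotics.isLittleO_iff_tendsto' ?_).mpr ?_
      · filter_upwards [eventually_gt_atTop 0] with x hx h
        exact absurd h hx.ne'
      · have h1 : Tendsto (fun x : ℝ ↦ (√x)⁻¹) atTop (𝓝 0) :=
          tendsto_sqrt_atTop.inv_tendsto_atTop
        simpa [sqrt_div_self'] using h1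
    simpa [sub_div] using tendsto_psi_div_self.sub h0
  -- Partial summation, with Chebyshev's bound for `θ`, shows that `π(x) - θ(x) / log x` is
  -- negligible.
  have hπ : Tendsto (fun x : ℝ ↦ (Nat.primeCounting ⌊x⌋₊ - theta x / log x) / (x / log x)) atTop
      (𝓝 0) := by
    refine (primeCounting_sub_theta_div_log_isBigO.trans_isLittleO ?_).tendsto_div_nhds_zero
    refine (Asymptotics.isLittleO_iff_tendsto' (by simp)).mpr ?_
    refine tendsto_log_atTop.inv_tendsto_atTop.congr' ?_
    filter_upwards [eventually_gt_atTop 1] with x hx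
    have := log_pos hx
    simp only [Pi.inv_apply]
    field_simp
  refine (Asymptotics.isEquivalent_iff_tendsto_one ?_).mpr ?_
  · filter_upwards [eventually_gt_atTop 1] with N hN
    exact one_div_ne_zero (log_pos (by exact_mod_cast hN)).ne'
  · have := (hπ.add hθ).comp tendsto_natCast_atTop_atTop
    rw [zero_add] at this
    refine this.congr' ?_
    filter_upwards [eventually_gt_atTop 1] with N hN
    have h1 : 0 < log (N : ℝ) := log_pos (by exact_mod_cast hN)
    have h2 : (0 : ℝ) < N := by positivity
    simp only [Function.comp_apply, Nat.floor_natCast, Pi.div_apply]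
    field_simp
    ring
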